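/- Let $q(m,n)=am^2+bmn+cn^2$ be a binary quadratic form with real coefficients and discriminant $D=b^2-4ac<0$, and let $\mathcal T$ be its topograph: the tree whose vertices are the superbases of $\mathbb Z^2$, i.e. unordered triples $\{v_1,v_2,v_3\}$ with $v_1+v_2+v_3=0$ and $\{v_1,v_2\}$ a basis of $\mathbb Z^2$, taken up to a common sign, and in which, for every basis $\{v,w\}$ of $\mathbb Z^2$, an edge joins $\{v,-w,-v+w\}$ and $\{v,w,-v-w\}$. The three regions adjacent to a vertex $\{v_1,v_2,v_3\}$ carry the labels $r,s,t=q(v_1),q(v_2),q(v_3)$. The edge oriented from $\{v,-w,-v+w\}$ to $\{v,w,-v-w\}$ carries the label $q(v)+q(w)-q(v-w)=q(v+w)-q(v)-q(w)$, which changes sign with the orientation; its adjacent regions are those of $\pm v$ and $\pm w$. The labels of the three edges at a vertex are denoted by $e,f,g$. Let $E$ be an oriented edge of $\mathcal T$ with label $e_0$ and adjacent region labels $r_0,t_0$, and let $\mathcal T'$ (the upper half relative to the root $E$) be the connected component of $\mathcal T\setminus E$ that contains the target of $E$. Suppose that $\mathcal T'$ is admissible, that is, the root $E$ (with its given orientation)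 and all edges of $\mathcal T'$ (oriented from the root to infinity) have positive labels, and $rstefg\neq 0$ at every vertex of $\mathcal T'$. Put $x=\frac{e_0}{r_0t_0}\cdot\frac{\sqrt{-D}}{2}$. Then $|x|\le 1$ and $$\sum_{V\in\mathcal T'}\frac1{|rst|}=\frac1D\left(\frac{e_0}{r_0t_0}-\frac{2\operatorname{Arcsin}(x)}{\sqrt{-D}}\right),\qquad \sum_{V\in\mathcal T'}\frac1{|efg|}=\frac1D\left(\frac{\arctan(\sqrt{-D}/e_0)}{\sqrt{-D}}-\frac1{e_0}\right),$$ where both sums run over all vertices of $\mathcal T'$ and converge, $\arctan$ is the principal branch, and $\operatorname{Arcsin}$ is the following branch of $\arcsin$: $\operatorname{Arcsin}(x)=\arcsin x$ (principal branch) if $e_0\ge\sqrt{-D}$, and $\operatorname{Arcsin}(x)=\pi-\arcsin x$ if $e_0<\sqrt{-D}$. -/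

import Mathlib

namespace Topograph

/-- Vectors of the lattice `ℤ²`. -/
abbrev Vec : Type := ℤ × ℤ

/-- The determinant of the `2 × 2` matrix with columns `v`, `w`. -/
def det (v w : Vec) : ℤ := v.1 * w.2 - v.2 * w.1

/-- An ordered basis `(v, w)` of `ℤ²` (two vectors form a basis iff their determinant is `±1`).
It encodes the oriented edge of the topograph that carries the bases `{±v, ±w}` and points from the
vertex `{v, -w, -v + w}` to the vertex `{v, w, -v - w}`. -/
@[ext] structure OrientedEdge where
  v : Vec
  w : Vec
  isBasis : IsUnit (det v w)

/-- A superbase with an ordering of its members: three vectors of `ℤ²` with sum zero, the first two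
of which form a basis of `ℤ²` (hence any two of them do). -/
structure Superbase where
  vec : Fin 3 → Vec
  sum_eq_zero : vec 0 + vec 1 + vec 2 = 0
  isBasis : IsUnit (det (vec 0) (vec 1))

/-- Two ordered superbases are identified if they agree up to the order of the three vectors and a
common sign. -/
instance Superbase.setoid : Setoid Superbase where
  r S T := ∃ σ : Equiv.Perm (Fin 3),
    (∀ i, T.vec i = S.vec (σ i)) ∨ (∀ i, T.vec i = -S.vec (σ i))
  iseqv :=
    { refl := fun S => ⟨1, Or.inl fun _ => rfl⟩
      symm := by
        rintro S T ⟨σ, h | h⟩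
        · exact ⟨σ⁻¹, Or.inl fun i => by simp [h]⟩
        · exact ⟨σ⁻¹, Or.inr fun i => by simp [h]⟩
      trans := by
        rintro S T U ⟨σ, h | h⟩ ⟨τ, k | k⟩
        · exact ⟨σ * τ, Or.inl fun i => by simp [h, k]⟩
        · exact ⟨σ * τ, Or.inr fun i => by simp [h, k]⟩
        · exact ⟨σ * τ, Or.inr fun i => by simp [h, k]⟩
        · exact ⟨σ * τ, Or.inl fun i => by simp [h, k]⟩ }

/-- The vertices of the topograph: (unordered) superbases up to sign. -/
def Vertex : Type := Quotient Superbase.setoid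

namespace OrientedEdge

/-- The superbase `{v, w, -v - w}` obtained from a basis `(v, w)`. -/
def superbase (E : OrientedEdge) : Superbase where
  vec := ![E.v, E.w, -E.v - E.w]
  sum_eq_zero := by simp
  isBasis := by simpa using E.isBasis

/-- The same edge with the opposite orientation. -/
def reverse (E : OrientedEdge) : OrientedEdge where
  v := E.v
  w := -E.w
  isBasis := by
    have h : det E.v (-E.w) = -det E.v E.w := by simp [det]; ring
    rw [h]
    exact E.isBasis.neg

/-- The target `{v, w, -v - w}`. -/
def target (E : OrientedEdge) : Vertex := Quotient.mk _ E.superbase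

/-- The source `{v, -w, -v + w}`. -/
def source (E : OrientedEdge) : Vertex := E.reverse.target

theorem reverse_reverse (E : OrientedEdge) : E.reverse.reverse = E := by
  ext <;> simp [reverse]

theorem source_ne_target (E : OrientedEdge) : E.source ≠ E.target := by
  intro h
  obtain ⟨σ, h⟩ := Quotient.exact h
  have hu := Int.isUnit_iff.mp E.isBasis
  obtain ⟨⟨a, b⟩, ⟨c, d⟩, hE⟩ := E
  simp only [det] at hu
  have h' : ∀ j : Fin 3,
      (![((a, b) : Vec), -(c, d), -(a, b) - -(c, d)] : Fin 3 → Vec) j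
          = ![((a, b) : Vec), (c, d), -(a, b) - (c, d)] (σ.symm j) ∨
      (![((a, b) : Vec), -(c, d), -(a, b) - -(c, d)] : Fin 3 → Vec) j
          = -![((a, b) : Vec), (c, d), -(a, b) - (c, d)] (σ.symm j) := by
    intro j
    rcases h with h | h
    · left
      have := h (σ.symm j)
      simpa [superbase, reverse] using this.symm
    · right
      have := h (σ.symm j)
      simp only [superbase, reverse, Equiv.apply_symm_apply] at this
      rw [this, neg_neg]
  have key := h' 2
  generalize σ.symm 2 = i at key
  have hcd : (a * d - b * c = 0) := by
    fin_cases i <;> simp [Prod.ext_iff] at key <;> rcases key with ⟨h1, h2⟩ | ⟨h1, h2⟩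
    · obtain rfl : c = 2 * a := by omega
      obtain rfl : d = 2 * b := by omega
      ring
    · obtain rfl : c = 0 := by omega
      obtain rfl : d = 0 := by omega
      ring
    · obtain rfl : a = 0 := by omega
      obtain rfl : b = 0 := by omega
      ring
    · obtain rfl : a = 2 * c := by omega
      obtain rfl : b = 2 * d := by omega
      ring
    · obtain rfl : c = 0 := by omega
      obtain rfl : d = 0 := by omega
      ring
    · obtain rfl : a = 0 := by omega
      obtain rfl : b = 0 := by omega
      ring
  omega

end OrientedEdge

/-- The topograph as a graph: superbases up to sign, with an edge between `{v, w, -v - w}` and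
`{v, -w, -v + w}` for every basis `(v, w)` of `ℤ²`. -/
def graph : SimpleGraph Vertex where
  Adj V W := ∃ E : OrientedEdge, E.source = V ∧ E.target = W
  symm := ⟨by
    rintro V W ⟨E, hV, hW⟩
    exact ⟨E.reverse, by rw [OrientedEdge.source, E.reverse_reverse, hW], hV⟩⟩
  loopless := ⟨by
    rintro V ⟨E, hV, hW⟩
    exact E.source_ne_target (hV.trans hW.symm)⟩

/-- The topograph with (the interior of) the edge `E` removed. -/
def graphWithout (E : OrientedEdge) : SimpleGraph Vertex :=
  graph.deleteEdges {s(E.source, E.target)}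

/-- The upper half relative to the root `E`: the vertices in the connected component of the target
of `E` after `E` has been removed. -/
def upperHalf (E : OrientedEdge) : Set Vertex :=
  {V | (graphWithout E).Reachable E.target V}

/-- `F` is the root `E` or an edge of the upper half relative to `E`, with the orientation
`from the root to infinity`: its target is in the upper half, and when `F` is removed, the source
of `F` stays connected to the source of `E`, so that the target of `F` is on the far side. -/
def IsOutward (E F : OrientedEdge) : Prop :=
  F.target ∈ upperHalf E ∧ (graphWithout F).Reachable E.source F.source

/-- The binary quadratic form `a m² + b m n + c n²` with real coefficients; it determines the labels
of a topograph. -/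
structure Form where
  a : ℝ
  b : ℝ
  c : ℝ

namespace Form

/-- The discriminant `b² - 4 a c`. -/
def disc (q : Form) : ℝ := q.b ^ 2 - 4 * q.a * q.c

/-- The value `q(v)`: the label of the region `±v`. -/
def regionLabel (q : Form) (v : Vec) : ℝ :=
  q.a * (v.1 : ℝ) ^ 2 + q.b * (v.1 : ℝ) * (v.2 : ℝ) + q.c * (v.2 : ℝ) ^ 2

theorem regionLabel_neg (q : Form) (v : Vec) : q.regionLabel (-v) = q.regionLabel v := by
  simp [regionLabel]

/-- The label `s + t - r` of an oriented edge, where `s = q(v)` and `t = q(w)` are the labels of the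
two regions along the edge and `r = q(v - w)` is the label of the third region at its source. -/
def edgeLabel (q : Form) (E : OrientedEdge) : ℝ :=
  q.regionLabel E.v + q.regionLabel E.w - q.regionLabel (E.v - E.w)

/-- The label of an edge is the middle coefficient of `q` in the basis `(v, w)`. -/
theorem edgeLabel_eq (q : Form) (E : OrientedEdge) :
    q.edgeLabel E = q.regionLabel (E.v + E.w) - q.regionLabel E.v - q.regionLabel E.w := by
  simp [edgeLabel, regionLabel]; ring

/-- The label of the edge that leaves the vertex `S` between the regions other than `i`: the sum of
the labels of these two regions minus the label of the region `i`. -/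
def outLabel (q : Form) (S : Superbase) (i : Fin 3) : ℝ :=
  (∑ j ∈ Finset.univ.erase i, q.regionLabel (S.vec j)) - q.regionLabel (S.vec i)

/-- The source of `E` has `E` as the edge that leaves it opposite to its third region. -/
theorem outLabel_reverse_superbase (q : Form) (E : OrientedEdge) :
    q.outLabel E.reverse.superbase 2 = q.edgeLabel E := by
  have h : (Finset.univ.erase (2 : Fin 3)) = {0, 1} := by decide
  have h' : q.regionLabel (-E.v + E.w) = q.regionLabel (E.v - E.w) := by
    rw [← regionLabel_neg, neg_add, neg_neg, ← sub_eq_add_neg]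
  simp [outLabel, h, edgeLabel, OrientedEdge.superbase, OrientedEdge.reverse, regionLabel_neg, h']

/-- With the edge labels `e`, `f`, `g` at any vertex, the discriminant is `-ef - fg - eg`. -/
theorem disc_eq (q : Form) (S : Superbase) :
    q.disc = -q.outLabel S 0 * q.outLabel S 1 - q.outLabel S 1 * q.outLabel S 2
      - q.outLabel S 0 * q.outLabel S 2 := by
  have h0 : (Finset.univ.erase (0 : Fin 3)) = {1, 2} := by decide
  have h1 : (Finset.univ.erase (1 : Fin 3)) = {0, 2} := by decide
  have h2 : (Finset.univ.erase (2 : Fin 3)) = {0, 1} := by decide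
  have hs : S.vec 2 = -(S.vec 0 + S.vec 1) := by
    have := S.sum_eq_zero
    rw [eq_neg_iff_add_eq_zero, add_comm]
    exact this
  have hu : ((det (S.vec 0) (S.vec 1) : ℤ) : ℝ) ^ 2 = 1 := by
    rcases Int.isUnit_iff.mp S.isBasis with h | h <;> simp [h]
  simp only [det] at hu
  push_cast at hu
  simp [outLabel, h0, h1, h2, hs]
  simp [regionLabel, disc]
  linear_combination (-(q.b ^ 2 - 4 * q.a * q.c)) * hu

theorem outLabel_perm (q : Form) {S T : Superbase} (σ : Equiv.Perm (Fin 3))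
    (h : ∀ i, q.regionLabel (T.vec i) = q.regionLabel (S.vec (σ i))) (i : Fin 3) :
    q.outLabel T i = q.outLabel S (σ i) := by
  have e1 := Finset.sum_erase_eq_sub (f := fun j => q.regionLabel (T.vec j)) (Finset.mem_univ i)
  have e2 := Finset.sum_erase_eq_sub (f := fun j => q.regionLabel (S.vec j))
    (Finset.mem_univ (σ i))
  have e3 : ∑ j, q.regionLabel (T.vec j) = ∑ j, q.regionLabel (S.vec j) := by
    simp only [h]
    exact Equiv.sum_comp σ fun j => q.regionLabel (S.vec j)
  rw [outLabel, outLabel, e1, e2, e3, h]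

theorem regionLabel_of_equiv (q : Form) {S T : Superbase} (h : S ≈ T) :
    ∃ σ : Equiv.Perm (Fin 3), ∀ i, q.regionLabel (T.vec i) = q.regionLabel (S.vec (σ i)) := by
  obtain ⟨σ, h | h⟩ := h
  · exact ⟨σ, fun i => by rw [h]⟩
  · exact ⟨σ, fun i => by rw [h, regionLabel_neg]⟩

/-- The product `r s t` of the labels of the three regions at a vertex. -/
def rst (q : Form) : Vertex → ℝ :=
  Quotient.lift (fun S : Superbase => ∏ i, q.regionLabel (S.vec i)) (by
    intro S T hST
    obtain ⟨σ, h⟩ := q.regionLabel_of_equiv hST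
    simp only [h]
    exact (Equiv.prod_comp σ fun i => q.regionLabel (S.vec i)).symm)

/-- The product `e f g` of the labels of the three edges at a vertex, all oriented away from this
vertex (a change of orientations only affects the sign of the product). -/
def efg (q : Form) : Vertex → ℝ :=
  Quotient.lift (fun S : Superbase => ∏ i, q.outLabel S i) (by
    intro S T hST
    obtain ⟨σ, h⟩ := q.regionLabel_of_equiv hST
    simp only [q.outLabel_perm σ h]
    exact (Equiv.prod_comp σ fun i => q.outLabel S i).symm)

/-- The upper half relative to `E` is admissible for the labels given by `q`: the root and all edges
of the upper half are oriented from the root to infinity, that is, their labels with respect to this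
orientation are positive, and no label at a vertex of the upper half vanishes. -/
def Admissible (q : Form) (E : OrientedEdge) : Prop :=
  (∀ F : OrientedEdge, IsOutward E F → 0 < q.edgeLabel F) ∧
    ∀ V ∈ upperHalf E, q.rst V * q.efg V ≠ 0

end Form

/-- The branches of `arcsin` on `[-1, 1]`: the `k`-th one takes its values in
`[k π - π / 2, k π + π / 2]`, and `k = 0` is the principal one. -/
noncomputable def arcsinBranch (k : ℤ) (x : ℝ) : ℝ :=
  k * Real.pi + (-1) ^ k * Real.arcsin x

end Topograph

/-! Write d = √(-D) and, for an edge with label e between regions r and t, put u = d/e and θ =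
arctan u. Since 4rt = e² + d², θ is the angle between the two vectors of the edge in the Euclidean
structure of q, and the x of the theorem is sin 2θ. The vector v + w splits this angle, so θ is the
sum of its values at the two following edges. With s = r + t + e, this makes e/(rt) - 4θ/d and θ/d -
1/e potentials: the value at an edge minus the values at the two following edges is D/(rst),
respectively D/|efg|.

The upper half is a rooted binary tree (`pathEquiv`), so both sums telescope (`hasSum_of_potential`)
up to the total potential at depth n. Divided by D, the potentials are nonnegative and O(u²θ). The
angles at depth n add up to the root angle and u = O(1/n) uniformly there, so the remainder tends to
0 (`Form.PosAt.hasSum`).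

Admissibility enters through the positivity of e₀, r₀, t₀ (`Form.Admissible.posAt`), which all later
edges inherit. -/

namespace Topograph

/-! ### Local structure of the topograph at a vertex. -/

namespace OrientedEdge

/-- The two edges that leave the target of `F`, other than `F` itself. -/
def child (F : OrientedEdge) : Bool → OrientedEdge
  | true => ⟨F.v, F.v + F.w, by
      have h : det F.v (F.v + F.w) = det F.v F.w := by simp [det]; ring
      rw [h]; exact F.isBasis⟩
  | false => ⟨F.v + F.w, F.w, by
      have h : det (F.v + F.w) F.w = det F.v F.w := by simp [det]; ring
      rw [h]; exact F.isBasis⟩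

/-- The edge reached from `E` by the sequence `l` of turns, the last turn standing first. -/
def path (E : OrientedEdge) : List Bool → OrientedEdge
  | [] => E
  | b :: l => (E.path l).child b

theorem target_eq_of_perm {F G : OrientedEdge} (σ : Equiv.Perm (Fin 3))
    (h : ∀ i, G.superbase.vec i = F.superbase.vec (σ i)) : F.target = G.target :=
  Quotient.sound ⟨σ, Or.inl h⟩

theorem target_eq_of_perm_neg {F G : OrientedEdge} (σ : Equiv.Perm (Fin 3))
    (h : ∀ i, G.superbase.vec i = -F.superbase.vec (σ i)) : F.target = G.target :=
  Quotient.sound ⟨σ, Or.inr h⟩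

theorem target_eq_of_eq {F G : OrientedEdge} (hv : G.v = F.v) (hw : G.w = F.w) :
    F.target = G.target := by
  rw [OrientedEdge.ext hv hw]

theorem target_eq_of_neg {F G : OrientedEdge} (hv : G.v = -F.v) (hw : G.w = -F.w) :
    F.target = G.target :=
  target_eq_of_perm_neg 1 fun i => by fin_cases i <;> simp [superbase, hv, hw]; abel

theorem target_eq_of_swap {F G : OrientedEdge} (hv : G.v = F.w) (hw : G.w = F.v) :
    F.target = G.target :=
  target_eq_of_perm (Equiv.swap 0 1) fun i => by
    fin_cases i
    · simp [superbase, hv]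
    · simp [superbase, hw]
    · rw [Equiv.swap_apply_of_ne_of_ne (by decide) (by decide)]
      simp [superbase, hv, hw]; abel

theorem target_eq_of_swap_neg {F G : OrientedEdge} (hv : G.v = -F.w) (hw : G.w = -F.v) :
    F.target = G.target :=
  target_eq_of_perm_neg (Equiv.swap 0 1) fun i => by
    fin_cases i
    · simp [superbase, hv]
    · simp [superbase, hw]
    · rw [Equiv.swap_apply_of_ne_of_ne (by decide) (by decide)]
      simp [superbase, hv, hw]

theorem child_source (F : OrientedEdge) (b : Bool) : (F.child b).source = F.target := by
  cases b
  · refine target_eq_of_perm_neg (Equiv.swap 0 2) fun i => ?_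
    fin_cases i
    · simp [superbase, child, reverse]
    · rw [Equiv.swap_apply_of_ne_of_ne (by decide) (by decide)]
      simp [superbase, child, reverse]
    · simp [superbase, child, reverse]; abel
  · refine target_eq_of_perm (Equiv.swap 1 2) fun i => ?_
    fin_cases i
    · rw [Equiv.swap_apply_of_ne_of_ne (by decide) (by decide)]
      simp [superbase, child, reverse]
    · simp [superbase, child, reverse]
    · simp [superbase, child, reverse]; abel

/-- The neighbours of the target of `F` are the source of `F` and the targets of its children. -/
theorem target_of_source_eq {F G : OrientedEdge} (h : G.source = F.target) :
    G.target = F.source ∨ ∃ b, G.target = (F.child b).target := by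
  obtain ⟨σ, h⟩ := Quotient.exact h
  have hne : σ.symm 0 ≠ σ.symm 1 := by simp
  have key : (G.v = F.superbase.vec (σ.symm 0) ∧ G.w = -F.superbase.vec (σ.symm 1)) ∨
      (G.v = -F.superbase.vec (σ.symm 0) ∧ G.w = F.superbase.vec (σ.symm 1)) := by
    rcases h with h | h
    · left
      rw [h, h, Equiv.apply_symm_apply, Equiv.apply_symm_apply]
      simp [superbase, reverse]
    · right
      rw [h, h, Equiv.apply_symm_apply, Equiv.apply_symm_apply]
      simp [superbase, reverse]
  generalize σ.symm 0 = i at *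
  generalize σ.symm 1 = j at *
  -- `G` is given by two distinct members of the superbase and a common sign, which leaves twelve
  -- cases. The pair v, w leads back to the source of `F`; a pair containing -v - w leads to a
  -- child.
  rw [Bool.exists_bool]
  rcases key with ⟨hv, hw⟩ | ⟨hv, hw⟩ <;> fin_cases i <;> fin_cases j <;>
    simp [superbase] at hv hw hne
  · exact Or.inl (target_eq_of_eq (by simp [reverse, hv]) (by simp [reverse, hw])).symm
  · exact Or.inr (Or.inr (target_eq_of_eq (by simp [child, hv]) (by simp [child, hw]; abel)).symm)
  · exact Or.inl (target_eq_of_swap_neg (by simp [reverse, hv]) (by simp [reverse, hw])).symm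
  · exact Or.inr (Or.inl (target_eq_of_swap (by simp [child, hv]) (by simp [child, hw]; abel)).symm)
  · exact Or.inr (Or.inr (target_eq_of_swap_neg (by simp [child, hv]; abel)
      (by simp [child, hw])).symm)
  · exact Or.inr (Or.inl (target_eq_of_neg (by simp [child, hv]; abel) (by simp [child, hw])).symm)
  · exact Or.inl (target_eq_of_neg (by simp [reverse, hv]) (by simp [reverse, hw])).symm
  · exact Or.inr (Or.inr (target_eq_of_neg (by simp [child, hv]) (by simp [child, hw]; abel)).symm)
  · exact Or.inl (target_eq_of_swap (by simp [reverse, hv]) (by simp [reverse, hw])).symm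
  · exact Or.inr (Or.inl (target_eq_of_swap_neg (by simp [child, hv])
      (by simp [child, hw]; abel)).symm)
  · exact Or.inr (Or.inr (target_eq_of_swap (by simp [child, hv]; abel) (by simp [child, hw])).symm)
  · exact Or.inr (Or.inl (target_eq_of_eq (by simp [child, hv]; abel) (by simp [child, hw])).symm)

/-- The vector v belongs to the first superbase, but it is parallel to none of v + w, w, -v - 2w,
the members of the second. -/
theorem target_child_ne (F : OrientedEdge) : (F.child true).target ≠ (F.child false).target := by
  intro h
  obtain ⟨σ, h⟩ := Quotient.exact h
  have hd : det F.v F.w ≠ 0 := F.isBasis.ne_zero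
  have key : det F.v ((F.child false).superbase.vec (σ.symm 0)) = 0 := by
    rcases h with h | h
    · rw [h, Equiv.apply_symm_apply]
      simp [superbase, child, det]; ring
    · rw [h, Equiv.apply_symm_apply]
      simp [superbase, child, det]; ring
  generalize σ.symm 0 = i at key
  simp only [det] at hd
  fin_cases i <;> simp [superbase, child, det] at key
  · exact hd (by linear_combination key)
  · exact hd (by linear_combination key)
  · have : 2 * (F.v.1 * F.w.2 - F.v.2 * F.w.1) = 0 := by linear_combination -key
    omega

end OrientedEdge

/-! ### Labels around an edge and propagation of positivity. -/

namespace Form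

variable (q : Form)

theorem edgeLabel_reverse (F : OrientedEdge) : q.edgeLabel F.reverse = -q.edgeLabel F := by
  simp [edgeLabel, OrientedEdge.reverse, regionLabel]; ring

theorem regionLabel_add (F : OrientedEdge) :
    q.regionLabel (F.v + F.w) = q.regionLabel F.v + q.regionLabel F.w + q.edgeLabel F := by
  rw [edgeLabel_eq]; ring

theorem edgeLabel_child_true (F : OrientedEdge) :
    q.edgeLabel (F.child true) = q.edgeLabel F + 2 * q.regionLabel F.v := by
  simp [edgeLabel, OrientedEdge.child, regionLabel]; ring

theorem edgeLabel_child_false (F : OrientedEdge) :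
    q.edgeLabel (F.child false) = q.edgeLabel F + 2 * q.regionLabel F.w := by
  simp [edgeLabel, OrientedEdge.child, regionLabel]; ring

theorem outLabel_superbase_zero (F : OrientedEdge) :
    q.outLabel F.superbase 0 = q.edgeLabel F + 2 * q.regionLabel F.w := by
  have h : (Finset.univ.erase (0 : Fin 3)) = {1, 2} := by decide
  simp [outLabel, h, edgeLabel, OrientedEdge.superbase, regionLabel]; ring

theorem outLabel_superbase_one (F : OrientedEdge) :
    q.outLabel F.superbase 1 = q.edgeLabel F + 2 * q.regionLabel F.v := by
  have h : (Finset.univ.erase (1 : Fin 3)) = {0, 2} := by decide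
  simp [outLabel, h, edgeLabel, OrientedEdge.superbase, regionLabel]; ring

theorem outLabel_superbase_two (F : OrientedEdge) :
    q.outLabel F.superbase 2 = -q.edgeLabel F := by
  have h : (Finset.univ.erase (2 : Fin 3)) = {0, 1} := by decide
  simp [outLabel, h, edgeLabel, OrientedEdge.superbase, regionLabel]; ring

theorem disc_eq_edge (F : OrientedEdge) :
    q.disc = q.edgeLabel F ^ 2 - 4 * (q.regionLabel F.v * q.regionLabel F.w) := by
  rw [q.disc_eq F.superbase, outLabel_superbase_zero, outLabel_superbase_one,
    outLabel_superbase_two]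
  ring

theorem rst_target (F : OrientedEdge) : q.rst F.target = q.regionLabel F.v * q.regionLabel F.w *
    (q.regionLabel F.v + q.regionLabel F.w + q.edgeLabel F) := by
  rw [← regionLabel_add, ← q.regionLabel_neg (F.v + F.w)]
  change ∏ i, q.regionLabel (F.superbase.vec i) = _
  rw [Fin.prod_univ_three, neg_add']
  simp [OrientedEdge.superbase]

theorem efg_target (F : OrientedEdge) : q.efg F.target = -(q.edgeLabel F *
    (q.edgeLabel F + 2 * q.regionLabel F.v) * (q.edgeLabel F + 2 * q.regionLabel F.w)) := by
  change ∏ i, q.outLabel F.superbase i = _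
  rw [Fin.prod_univ_three, outLabel_superbase_zero, outLabel_superbase_one,
    outLabel_superbase_two]
  ring

/-- The sum of the labels of the three regions at a vertex. -/
def total : Vertex → ℝ :=
  Quotient.lift (fun S : Superbase => ∑ i, q.regionLabel (S.vec i)) (by
    intro S T hST
    obtain ⟨σ, h⟩ := q.regionLabel_of_equiv hST
    simp only [h]
    exact (Equiv.sum_comp σ fun i => q.regionLabel (S.vec i)).symm)

theorem total_target (F : OrientedEdge) :
    q.total F.target = 2 * (q.regionLabel F.v + q.regionLabel F.w) + q.edgeLabel F := by
  change ∑ i, q.regionLabel (F.superbase.vec i) = _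
  rw [Fin.sum_univ_three]
  simp [OrientedEdge.superbase, edgeLabel, regionLabel]; ring

theorem total_source (F : OrientedEdge) :
    q.total F.source = 2 * (q.regionLabel F.v + q.regionLabel F.w) - q.edgeLabel F := by
  rw [OrientedEdge.source, total_target, edgeLabel_reverse]
  simp [OrientedEdge.reverse, regionLabel_neg]; ring

/-- The labels of the edge `F` and of the two regions along it are positive. -/
structure PosAt (F : OrientedEdge) : Prop where
  v : 0 < q.regionLabel F.v
  w : 0 < q.regionLabel F.w
  edge : 0 < q.edgeLabel F

variable {q}

theorem PosAt.child {F : OrientedEdge} (h : q.PosAt F) (b : Bool) : q.PosAt (F.child b) := by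
  have hv := h.v
  have hw := h.w
  have he := h.edge
  cases b
  · refine ⟨?_, hw, ?_⟩
    · change 0 < q.regionLabel (F.v + F.w)
      rw [regionLabel_add]; positivity
    · rw [edgeLabel_child_false]; positivity
  · refine ⟨hv, ?_, ?_⟩
    · change 0 < q.regionLabel (F.v + F.w)
      rw [regionLabel_add]; positivity
    · rw [edgeLabel_child_true]; positivity

theorem PosAt.path {E : OrientedEdge} (h : q.PosAt E) : ∀ l, q.PosAt (E.path l)
  | [] => h
  | b :: l => (PosAt.path h l).child b

/-- Along an edge with label e the total grows by 2e. It thus serves as a height function that rules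
out cycles and returns to the source. -/
theorem PosAt.total_source_lt {F : OrientedEdge} (h : q.PosAt F) :
    q.total F.source < q.total F.target := by
  rw [total_source, total_target]
  linarith [h.edge]

theorem PosAt.total_le_path {E : OrientedEdge} (h : q.PosAt E) :
    ∀ l, q.total E.target ≤ q.total (E.path l).target
  | [] => le_rfl
  | b :: l => by
      have h1 := (h.path (b :: l)).total_source_lt
      rw [OrientedEdge.path, OrientedEdge.child_source] at h1
      exact (PosAt.total_le_path h l).trans h1.le

theorem PosAt.source_ne_path {E : OrientedEdge} (h : q.PosAt E) (l : List Bool) :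
    E.source ≠ (E.path l).target := fun he =>
  absurd (h.total_le_path l) (by rw [← he]; exact not_le.mpr h.total_source_lt)

/-- Only one of the edges at a vertex is directed towards it, so that this edge is determined. -/
theorem PosAt.source_eq {F G : OrientedEdge} (hF : q.PosAt F) (hG : q.PosAt G)
    (h : F.target = G.target) : F.source = G.source := by
  obtain ⟨σ, h⟩ := Quotient.exact h
  have hlab : ∀ i, q.regionLabel (G.superbase.vec i) = q.regionLabel (F.superbase.vec (σ i)) := by
    intro i
    rcases h with h | h
    · rw [h]
    · rw [h, regionLabel_neg]
  have h2 := q.outLabel_perm σ hlab 2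
  rw [outLabel_superbase_two] at h2
  -- The outward label at index 2 is negative for both edges, while those of `F` at indices 0 and 1
  -- are positive.
  have hσ : σ 2 = 2 := by
    have hv := hF.v
    have hw := hF.w
    have he := hF.edge
    have he' := hG.edge
    generalize σ 2 = i at h2
    fin_cases i
    · simp only [Fin.zero_eta, outLabel_superbase_zero] at h2
      linarith
    · simp only [Fin.mk_one, outLabel_superbase_one] at h2
      linarith
    · rfl
  have h0 : σ 0 ≠ 2 := fun h => absurd (σ.injective (h.trans hσ.symm)) (by decide)
  have h1 : σ 1 ≠ 2 := fun h => absurd (σ.injective (h.trans hσ.symm)) (by decide)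
  have h01 : σ 0 ≠ σ 1 := fun h => absurd (σ.injective h) (by decide)
  have hc : (σ 0 = 0 ∧ σ 1 = 1) ∨ (σ 0 = 1 ∧ σ 1 = 0) := by
    generalize σ 0 = i at *
    generalize σ 1 = j at *
    revert i j; decide
  have hs : ∀ K : OrientedEdge, K.superbase.vec 0 = K.v ∧ K.superbase.vec 1 = K.w :=
    fun K => ⟨rfl, rfl⟩
  rcases h with h | h <;> have e0 := h 0 <;> have e1 := h 1 <;>
    rcases hc with ⟨c0, c1⟩ | ⟨c0, c1⟩ <;>
    simp only [c0, c1, hs] at e0 e1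
  · exact OrientedEdge.target_eq_of_eq e0 (congrArg Neg.neg e1)
  · exact OrientedEdge.target_eq_of_swap_neg (by simp [OrientedEdge.reverse, e0])
      (by simp [OrientedEdge.reverse, e1])
  · exact OrientedEdge.target_eq_of_neg e0 (congrArg Neg.neg e1)
  · exact OrientedEdge.target_eq_of_swap (by simp [OrientedEdge.reverse, e0])
      (by simp [OrientedEdge.reverse, e1])

/-- A form that takes the labels `1`, `1`, `1` along the edge `E`. -/
theorem exists_posAt (E : OrientedEdge) : ∃ q : Form, q.PosAt E := by
  obtain ⟨⟨a, b⟩, ⟨c, d⟩, h⟩ := E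
  have hu : ((a * d - b * c : ℤ) : ℝ) ^ 2 = 1 := by
    rcases Int.isUnit_iff.mp h with h | h <;> simp only [det] at h <;> simp [h]
  push_cast at hu
  -- This is m² + mn + n² in the coordinates m, n with respect to the basis, obtained by Cramer's
  -- rule; the sign of the determinant disappears in the squares and the product.
  refine ⟨⟨d ^ 2 - d * b + b ^ 2, -2 * c * d + d * a + c * b - 2 * a * b,
    c ^ 2 - c * a + a ^ 2⟩, ⟨?_, ?_, ?_⟩⟩
  · simp only [regionLabel]
    exact one_pos.trans_eq (by linear_combination -hu)
  · simp only [regionLabel]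
    exact one_pos.trans_eq (by linear_combination -hu)
  · simp only [regionLabel, edgeLabel, Prod.fst_sub, Prod.snd_sub]
    push_cast
    exact one_pos.trans_eq (by linear_combination -hu)

end Form

/-! ### The upper half as a rooted binary tree. -/

namespace OrientedEdge

/-- For an auxiliary form positive along `E`, a vertex determines the source of its incoming edge.
Hence the last turns can be peeled off, and the two children of one edge have distinct targets. -/
theorem path_target_injective (E : OrientedEdge) :
    Function.Injective fun l => (E.path l).target := by
  obtain ⟨q, hq⟩ := Form.exists_posAt E
  intro l
  induction l with
  | nil =>
    rintro (_ | ⟨b, m⟩) h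
    · rfl
    · have := (hq.path []).source_eq (hq.path (b :: m)) h
      rw [path, path, child_source] at this
      exact absurd this (hq.source_ne_path m)
  | cons a l ih =>
    rintro (_ | ⟨b, m⟩) h
    · have := (hq.path []).source_eq (hq.path (a :: l)) h.symm
      rw [path, path, child_source] at this
      exact absurd this (hq.source_ne_path l)
    · have := (hq.path (a :: l)).source_eq (hq.path (b :: m)) h
      rw [path, path, child_source, child_source] at this
      obtain rfl := ih this
      cases a <;> cases b
      · rfl
      · exact absurd h.symm (target_child_ne _)
      · exact absurd h (target_child_ne _)
      · rfl

theorem path_target_mem (E : OrientedEdge) : ∀ l, (E.path l).target ∈ upperHalf E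
  | [] => SimpleGraph.Reachable.refl _
  | b :: l => by
      obtain ⟨q, hq⟩ := Form.exists_posAt E
      refine SimpleGraph.Reachable.trans (path_target_mem E l) (SimpleGraph.Adj.reachable ?_)
      refine SimpleGraph.deleteEdges_adj.mpr ⟨⟨_, child_source _ b, rfl⟩, ?_⟩
      -- The deleted edge contains the source of `E`, which lies strictly lower than every target of
      -- a path.
      intro h
      rcases Sym2.eq_iff.mp (Set.mem_singleton_iff.mp h) with ⟨h, -⟩ | ⟨-, h⟩
      · exact hq.source_ne_path l h.symm
      · exact hq.source_ne_path (b :: l) h.symm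

/-- The targets of paths are closed under adjacency: a neighbour is reached by one more turn or by
undoing the last one. At the root, undoing would need the deleted edge. -/
theorem exists_path_of_mem {E : OrientedEdge} {V : Vertex} (h : V ∈ upperHalf E) :
    ∃ l, (E.path l).target = V := by
  obtain ⟨p⟩ := (h : (graphWithout E).Reachable E.target V)
  suffices H : ∀ {A B : Vertex}, (graphWithout E).Walk A B → (∃ l, (E.path l).target = A) →
      ∃ l, (E.path l).target = B from H p ⟨[], rfl⟩
  intro A B p
  induction p with
  | nil => exact id
  | @cons A C B hadj p ih =>
    rintro ⟨l, rfl⟩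
    refine ih ?_
    obtain ⟨⟨G, hG, rfl⟩, hdel⟩ := SimpleGraph.deleteEdges_adj.mp hadj
    rcases target_of_source_eq hG with h | ⟨b, h⟩
    · cases l with
      | nil => exact absurd (by rw [h]; exact Sym2.eq_swap) hdel
      | cons b l => exact ⟨l, by rw [h, path, child_source]⟩
    · exact ⟨b :: l, h.symm⟩

/-- The vertices of the upper half correspond to the finite sequences of turns. -/
noncomputable def pathEquiv (E : OrientedEdge) : List Bool ≃ upperHalf E :=
  Equiv.ofBijective (fun l => ⟨(E.path l).target, E.path_target_mem l⟩)
    ⟨fun _ _ h => E.path_target_injective (congrArg Subtype.val h),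
      fun V => (exists_path_of_mem V.2).imp fun _ h => Subtype.ext h⟩

/-- Heights increase along the path, so all its vertices are lower than `B` and it cannot use an
edge ending at `B`. Taking for `B` the target of a later edge shows that this edge is outward. -/
theorem reachable_path {q : Form} {E : OrientedEdge} (hq : q.PosAt E) {A B : Vertex} :
    ∀ l, q.total (E.path l).target < q.total B →
      (graph.deleteEdges {s(A, B)}).Reachable E.source (E.path l).target := by
  have step : ∀ l, q.total (E.path l).target < q.total B →
      (graph.deleteEdges {s(A, B)}).Adj (E.path l).source (E.path l).target := by
    intro l hl
    refine SimpleGraph.deleteEdges_adj.mpr ⟨⟨_, rfl, rfl⟩, fun h => ?_⟩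
    have hlt := (hq.path l).total_source_lt
    rcases Sym2.eq_iff.mp (Set.mem_singleton_iff.mp h) with ⟨-, h⟩ | ⟨h, -⟩
    · exact hl.ne (congrArg _ h)
    · exact (hlt.trans hl).ne (congrArg _ h)
  intro l
  induction l with
  | nil => exact fun hl => (step [] hl).reachable
  | cons b l ih =>
    intro hl
    have hlt := (hq.path (b :: l)).total_source_lt
    have hs : (E.path (b :: l)).source = (E.path l).target := child_source _ b
    have hadj := step _ hl
    rw [hs] at hlt hadj
    exact (ih (hlt.trans hl)).trans hadj.reachable

theorem isOutward_path (E : OrientedEdge) (l : List Bool) : IsOutward E (E.path l) := by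
  refine ⟨E.path_target_mem l, ?_⟩
  cases l with
  | nil => exact SimpleGraph.Reachable.refl _
  | cons b l =>
    obtain ⟨q, hq⟩ := Form.exists_posAt E
    have hlt := (hq.path (b :: l)).total_source_lt
    have hs : (E.path (b :: l)).source = (E.path l).target := child_source _ b
    rw [hs] at hlt ⊢
    exact reachable_path hq l hlt

end OrientedEdge

/-- In an admissible upper half of a definite form, the form is positive definite. -/
theorem Form.Admissible.posAt {q : Form} {E : OrientedEdge} (h : q.Admissible E)
    (hD : q.disc < 0) : q.PosAt E := by
  -- Walking along the boundary of the region of `E.v`, the edge labels form an arithmetic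
  -- progression; a negative region label would eventually make them negative.
  have hk : ∀ k : ℕ, (E.path (List.replicate k true)).v = E.v ∧
      q.edgeLabel (E.path (List.replicate k true)) = q.edgeLabel E + k * (2 * q.regionLabel E.v) := by
    intro k
    induction k with
    | zero => simp [OrientedEdge.path]
    | succ k ih =>
      rw [List.replicate_succ, OrientedEdge.path, edgeLabel_child_true, ih.2, ih.1]
      exact ⟨ih.1, by push_cast; ring⟩
  have he : 0 < q.edgeLabel E := h.1 _ (E.isOutward_path [])
  have hprod : 0 < q.regionLabel E.v * q.regionLabel E.w := by
    rw [q.disc_eq_edge E] at hD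
    nlinarith [sq_nonneg (q.edgeLabel E)]
  have hr : 0 < q.regionLabel E.v := by
    by_contra hr
    have hr' : q.regionLabel E.v < 0 :=
      lt_of_le_of_ne (not_lt.mp hr) fun h0 => by simp [h0] at hprod
    obtain ⟨k, hk'⟩ := Archimedean.arch (q.edgeLabel E) (y := -(2 * q.regionLabel E.v)) (by linarith)
    have := h.1 _ (E.isOutward_path (List.replicate k true))
    rw [(hk k).2] at this
    rw [nsmul_eq_mul] at hk'
    linarith
  exact ⟨hr, pos_of_mul_pos_right hprod hr.le, he⟩

end Topograph

/-! ### Telescoping sums over a binary tree. -/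

namespace Topograph

open Finset Filter Topology

/-- Adding a turn to a sequence of turns. -/
def consEmbedding : Bool × List Bool ↪ List Bool :=
  ⟨fun p => p.1 :: p.2, fun _ _ h => Prod.ext (List.cons.inj h).1 (List.cons.inj h).2⟩

theorem consEmbedding_apply (b : Bool) (l : List Bool) : consEmbedding (b, l) = b :: l := rfl

/-- The sequences of turns of length `n`. -/
def turns : ℕ → Finset (List Bool)
  | 0 => {[]}
  | n + 1 => (univ ×ˢ turns n).map consEmbedding

theorem mem_turns {n : ℕ} {l : List Bool} : l ∈ turns n ↔ l.length = n := by
  induction n generalizing l with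
  | zero => simp [turns]
  | succ n ih =>
    cases l with
    | nil => simp [turns, consEmbedding_apply]
    | cons b l => simp [turns, consEmbedding_apply, ← ih]

theorem sum_turns_succ (Φ : List Bool → ℝ) (n : ℕ) :
    ∑ l ∈ turns (n + 1), Φ l = ∑ l ∈ turns n, (Φ (true :: l) + Φ (false :: l)) := by
  rw [turns, sum_map, sum_product_right]
  simp [consEmbedding_apply]

/-- Telescoping over a binary tree: a nonnegative function `f` is summed by a potential `Φ` if the
total of `Φ` over the sequences of length `n` tends to zero. -/
theorem hasSum_of_potential {f Φ : List Bool → ℝ} (hf : ∀ l, 0 ≤ f l)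
    (hΦ : ∀ l, Φ l = f l + (Φ (true :: l) + Φ (false :: l)))
    (hlim : Tendsto (fun n => ∑ l ∈ turns n, Φ l) atTop (𝓝 0)) : HasSum f (Φ []) := by
  have hpart : ∀ n, ∑ l ∈ (range n).biUnion turns, f l = Φ [] - ∑ l ∈ turns n, Φ l := by
    intro n
    rw [sum_biUnion fun i _ j _ hij => Finset.disjoint_left.mpr fun l hi hj =>
      hij ((mem_turns.mp hi).symm.trans (mem_turns.mp hj))]
    induction n with
    | zero => simp [turns]
    | succ n ih =>
      rw [sum_range_succ, ih, sum_turns_succ]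
      have : ∑ l ∈ turns n, Φ l = ∑ l ∈ turns n, f l +
          ∑ l ∈ turns n, (Φ (true :: l) + Φ (false :: l)) := by
        rw [← sum_add_distrib]
        exact sum_congr rfl fun l _ => hΦ l
      linarith
  have hT : Tendsto (fun n => (range n).biUnion turns) atTop atTop := by
    refine tendsto_atTop_finset_of_monotone
      (fun m n h => biUnion_subset_biUnion_of_subset_left _ (range_mono h)) fun l => ?_
    exact ⟨l.length + 1, mem_biUnion.mpr ⟨l.length, by simp, mem_turns.mpr rfl⟩⟩
  have hlim' : Tendsto (fun n => ∑ l ∈ (range n).biUnion turns, f l) atTop (𝓝 (Φ [])) := by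
    simp only [hpart]
    simpa using hlim.const_sub (Φ [])
  have hmono : Monotone fun n => ∑ l ∈ (range n).biUnion turns, f l := fun m n h =>
    sum_le_sum_of_subset_of_nonneg
      (biUnion_subset_biUnion_of_subset_left _ (range_mono h)) fun l _ _ => hf l
  -- For nonnegative terms, bounded sums over an exhausting sequence of finite sets suffice; the
  -- limit along that sequence then identifies the sum.
  have hsum : Summable f := by
    refine summable_of_sum_le (c := Φ []) hf fun u => ?_
    obtain ⟨n, hn⟩ := (hT.eventually_ge_atTop u).exists
    exact (sum_le_sum_of_subset_of_nonneg hn fun l _ _ => hf l).trans (hmono.ge_of_tendsto hlim' n)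
  have := hsum.hasSum
  rwa [tendsto_nhds_unique (this.comp hT) hlim'] at this

/-! ### Estimates and identities for the arctangent. -/

theorem arctan_le_self {u : ℝ} (hu : 0 ≤ u) : Real.arctan u ≤ u := by
  simpa using Real.le_tan (Real.arctan_nonneg.mpr hu) (Real.arctan_lt_pi_div_two u)

theorem sin_two_mul_arctan (u : ℝ) : Real.sin (2 * Real.arctan u) = 2 * u / (1 + u ^ 2) := by
  have h : 0 < 1 + u ^ 2 := by positivity
  rw [Real.sin_two_mul, Real.sin_arctan, Real.cos_arctan]
  have : √(1 + u ^ 2) ≠ 0 := (Real.sqrt_pos.mpr h).ne'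
  field_simp
  rw [Real.sq_sqrt h.le]

theorem div_le_arctan {u : ℝ} (hu : 0 ≤ u) : u / (1 + u ^ 2) ≤ Real.arctan u := by
  have h := Real.sin_le (x := 2 * Real.arctan u) (by have := Real.arctan_nonneg.mpr hu; positivity)
  rw [sin_two_mul_arctan, mul_div_assoc] at h
  linarith

/-- Replacing u by the smaller arctan u in the fraction leaves u² arctan u / (1 + u²). This and
`sub_arctan_le` give the third-order bounds on the two potentials. -/
theorem arctan_sub_div_le {u : ℝ} (hu : 0 ≤ u) :
    Real.arctan u - u / (1 + u ^ 2) ≤ u ^ 2 * Real.arctan u := by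
  have h1 := arctan_le_self hu
  have h2 : Real.arctan u / (1 + u ^ 2) ≤ u / (1 + u ^ 2) := by gcongr
  have h3 : Real.arctan u - Real.arctan u / (1 + u ^ 2) ≤ u ^ 2 * Real.arctan u := by
    have h4 := Real.arctan_nonneg.mpr hu
    have : Real.arctan u - Real.arctan u / (1 + u ^ 2)
        = (u ^ 2 * Real.arctan u) / (1 + u ^ 2) := by
      field_simp; ring
    rw [this]
    exact div_le_self (by positivity) (by nlinarith)
  linarith

theorem sub_arctan_le {u : ℝ} (hu : 0 ≤ u) : u - Real.arctan u ≤ u ^ 2 * Real.arctan u := by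
  have h := div_le_arctan hu
  rw [div_le_iff₀ (by positivity)] at h
  linarith

/-- The angle along an edge is the sum of the angles along the two following edges. -/
theorem arctan_add_arctan_of_disc {r t e d : ℝ} (hr : 0 < r) (ht : 0 < t) (he : 0 < e)
    (hd : d ^ 2 = 4 * (r * t) - e ^ 2) :
    Real.arctan (d / (e + 2 * r)) + Real.arctan (d / (e + 2 * t)) = Real.arctan (d / e) := by
  -- The addition formula needs this product below 1, and d² < 4rt < (e + 2r)(e + 2t).
  have h : d / (e + 2 * r) * (d / (e + 2 * t)) < 1 := by
    rw [div_mul_div_comm, div_lt_one (by positivity)]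
    have : 0 < e * r := by positivity
    have : 0 < e * t := by positivity
    nlinarith
  rw [Real.arctan_add h]
  congr 1
  rw [div_eq_div_iff (sub_pos.mpr h).ne' he.ne']
  field_simp
  linear_combination d * hd

/-- `Arcsin (sin 2θ) = 2θ` for `θ = arctan (d / e)`, in the branch of the theorem. -/
theorem arcsinBranch_eq {d e : ℝ} (hd : 0 < d) (he : 0 < e) :
    arcsinBranch (if d ≤ e then 0 else 1) (2 * (d / e) / (1 + (d / e) ^ 2)) =
      2 * Real.arctan (d / e) := by
  have hpos := Real.arctan_pos.mpr (div_pos hd he)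
  rw [← sin_two_mul_arctan, arcsinBranch]
  -- The condition d ≤ e means 2θ ≤ π/2. Beyond that, π - 2θ is the principal arcsine of sin 2θ.
  split_ifs with h
  · have : Real.arctan (d / e) ≤ Real.pi / 4 := by
      rw [← Real.arctan_one]
      exact Real.arctan_mono ((div_le_one he).mpr h)
    rw [Real.arcsin_sin (by linarith [Real.pi_pos]) (by linarith)]
    simp
  · have : Real.pi / 4 ≤ Real.arctan (d / e) := by
      rw [← Real.arctan_one]
      exact Real.arctan_mono ((one_le_div he).mpr (not_le.mp h).le)
    rw [← Real.sin_pi_sub, Real.arcsin_sin (by linarith [Real.arctan_lt_pi_div_two (d / e)])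
      (by linarith)]
    simp

/-! ### Angles, decay of the potentials and the two sums. -/

namespace Form

variable {q : Form} {E : OrientedEdge}

/-- The angle, in the Euclidean structure given by `q`, between the vectors of the edge `F`. -/
noncomputable def angle (q : Form) (F : OrientedEdge) : ℝ :=
  Real.arctan (√(-q.disc) / q.edgeLabel F)

/-- The diagonal v + w divides the angle from v to w into two. -/
theorem PosAt.angle_child {F : OrientedEdge} (h : q.PosAt F) (hD : q.disc < 0) :
    q.angle (F.child true) + q.angle (F.child false) = q.angle F := by
  rw [angle, angle, edgeLabel_child_true, edgeLabel_child_false]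
  refine arctan_add_arctan_of_disc h.v h.w h.edge ?_
  rw [Real.sq_sqrt (by linarith), q.disc_eq_edge F]
  ring

theorem PosAt.sum_angle (h : q.PosAt E) (hD : q.disc < 0) (n : ℕ) :
    ∑ l ∈ turns n, q.angle (E.path l) = q.angle E := by
  induction n with
  | zero => simp [turns, OrientedEdge.path]
  | succ n ih =>
    rw [sum_turns_succ fun l => q.angle (E.path l), ← ih]
    exact sum_congr rfl fun l _ => (h.path l).angle_child hD

/-- Each new region label is the sum of two old ones and a positive edge label, so a lower bound
persists. -/
theorem PosAt.le_path {m : ℝ} (h : q.PosAt E) (hv : m ≤ q.regionLabel E.v)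
    (hw : m ≤ q.regionLabel E.w) (l : List Bool) :
    m ≤ q.regionLabel (E.path l).v ∧ m ≤ q.regionLabel (E.path l).w := by
  induction l with
  | nil => exact ⟨hv, hw⟩
  | cons b l ih =>
    have hadd := q.regionLabel_add (E.path l)
    have hl := h.path l
    have : m ≤ q.regionLabel ((E.path l).v + (E.path l).w) := by
      linarith [hl.w, hl.edge, ih.1]
    cases b
    · exact ⟨this, ih.2⟩
    · exact ⟨ih.1, this⟩

/-- The edge labels grow at least linearly with the distance from the root. -/
theorem PosAt.length_mul_le (h : q.PosAt E) (l : List Bool) :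
    l.length * (2 * min (q.regionLabel E.v) (q.regionLabel E.w)) ≤ q.edgeLabel (E.path l) := by
  induction l with
  | nil => simpa [OrientedEdge.path] using h.edge.le
  | cons b l ih =>
    obtain ⟨h1, h2⟩ := h.le_path (min_le_left _ _) (min_le_right _ _) l
    rw [List.length_cons, OrientedEdge.path]
    push_cast
    cases b
    · rw [edgeLabel_child_false]; linarith
    · rw [edgeLabel_child_true]; linarith

/-- Summation over the upper half by a potential dominated by the angle to the third order. -/
theorem PosAt.hasSum (h : q.PosAt E) (hD : q.disc < 0) {f : Vertex → ℝ} {Φ : OrientedEdge → ℝ}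
    {C : ℝ} (hC : 0 ≤ C) (hf : ∀ V, 0 ≤ f V)
    (hΦ : ∀ F, q.PosAt F → Φ F = f F.target + (Φ (F.child true) + Φ (F.child false)))
    (hnonneg : ∀ F, q.PosAt F → 0 ≤ Φ F)
    (hle : ∀ F, q.PosAt F → Φ F ≤ C * ((√(-q.disc) / q.edgeLabel F) ^ 2 * q.angle F)) :
    HasSum (fun V : upperHalf E => f V) (Φ E) := by
  rw [← E.pathEquiv.hasSum_iff]
  refine hasSum_of_potential (f := fun l => f (E.path l).target) (Φ := fun l => Φ (E.path l))
    (fun l => hf _) (fun l => hΦ _ (h.path l)) ?_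
  set m := min (q.regionLabel E.v) (q.regionLabel E.w) with hm
  have hmpos : 0 < m := lt_min h.v h.w
  have hang : ∀ F, q.PosAt F → 0 ≤ q.angle F := fun F hF =>
    Real.arctan_nonneg.mpr (div_nonneg (Real.sqrt_nonneg _) hF.edge.le)
  have hlim : Tendsto (fun n : ℕ => C * (√(-q.disc) / (n * (2 * m))) ^ 2 * q.angle E) atTop (𝓝 0) := by
    have h1 : Tendsto (fun n : ℕ => √(-q.disc) / ((n : ℝ) * (2 * m))) atTop (𝓝 0) :=
      (tendsto_natCast_atTop_atTop.atTop_mul_const (by positivity)).const_div_atTop _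
    simpa using ((h1.pow 2).const_mul C).mul_const (q.angle E)
  refine squeeze_zero' (Eventually.of_forall fun n => sum_nonneg fun l _ => hnonneg _ (h.path l))
    ?_ hlim
  -- At depth 0 the bound would be 0, by the convention for division by zero.
  filter_upwards [eventually_gt_atTop 0] with n hn
  rw [← h.sum_angle hD n, mul_sum]
  refine sum_le_sum fun l hl => (hle _ (h.path l)).trans ?_
  have hlen := h.length_mul_le l
  rw [mem_turns.mp hl] at hlen
  have hn' : (0 : ℝ) < n := by exact_mod_cast hn
  have := hang _ (h.path l)
  have := (h.path l).edge
  rw [← mul_assoc]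
  gcongr

theorem PosAt.hasSum_rst (h : q.PosAt E) (hD : q.disc < 0) :
    HasSum (fun V : upperHalf E => 1 / |q.rst V|)
      (1 / q.disc * (q.edgeLabel E / (q.regionLabel E.v * q.regionLabel E.w) -
        4 * q.angle E / √(-q.disc))) := by
  have hd : 0 < √(-q.disc) := Real.sqrt_pos.mpr (by linarith)
  have hd2 : √(-q.disc) ^ 2 = -q.disc := Real.sq_sqrt (by linarith)
  -- Substituting rt = (e² + d²)/4 turns the potential into (4/d³)(θ - u/(1 + u²)), which shows its
  -- sign and size.
  have hΦ : ∀ F, q.PosAt F → 1 / q.disc * (q.edgeLabel F / (q.regionLabel F.v * q.regionLabel F.w) -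
        4 * q.angle F / √(-q.disc)) = 4 / (-q.disc * √(-q.disc)) *
        (Real.arctan (√(-q.disc) / q.edgeLabel F) - √(-q.disc) / q.edgeLabel F /
          (1 + (√(-q.disc) / q.edgeLabel F) ^ 2)) := by
    intro F hF
    have he := hF.edge
    have hv := hF.v
    have hw := hF.w
    have h1 : q.regionLabel F.v * q.regionLabel F.w =
        (q.edgeLabel F ^ 2 + √(-q.disc) ^ 2) / 4 := by
      rw [hd2, q.disc_eq_edge F]; ring
    rw [h1, angle]
    have hdisc : q.disc = -√(-q.disc) ^ 2 := by rw [hd2]; ring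
    generalize √(-q.disc) = d at *
    rw [hdisc]
    field_simp
    ring
  refine h.hasSum hD (f := fun V => 1 / |q.rst V|) (C := 4 / (-q.disc * √(-q.disc)))
    (Φ := fun F => 1 / q.disc * (q.edgeLabel F / (q.regionLabel F.v * q.regionLabel F.w) -
        4 * q.angle F / √(-q.disc))) ?_ (fun V => by positivity) ?_ ?_ ?_
  · have : 0 < -q.disc := by linarith
    positivity
  -- The angles cancel, and es - (e + 2r)t - (e + 2t)r = e² - 4rt = D.
  · intro F hF
    have he := hF.edge
    have hv := hF.v
    have hw := hF.w
    have hs := q.regionLabel_add F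
    have hang := hF.angle_child hD
    rw [rst_target, abs_of_pos (by positivity), ← hang, edgeLabel_child_true,
      edgeLabel_child_false]
    simp only [OrientedEdge.child, hs]
    have hdisc := q.disc_eq_edge F
    have hne := hD.ne
    have hs' : q.regionLabel F.v + q.regionLabel F.w + q.edgeLabel F ≠ 0 := by positivity
    generalize q.angle _ = θ₁
    generalize q.angle _ = θ₂
    generalize √(-q.disc) = d at *
    generalize q.disc = D at *
    field_simp
    rw [hdisc]
    ring
  · intro F hF
    rw [hΦ F hF]
    have := div_le_arctan (div_pos hd hF.edge).le
    have : 0 < -q.disc := by linarith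
    refine mul_nonneg (by positivity) (by linarith)
  · intro F hF
    rw [hΦ F hF]
    have : 0 < -q.disc := by linarith
    exact mul_le_mul_of_nonneg_left (arctan_sub_div_le (div_pos hd hF.edge).le) (by positivity)

theorem PosAt.hasSum_efg (h : q.PosAt E) (hD : q.disc < 0) :
    HasSum (fun V : upperHalf E => 1 / |q.efg V|)
      (1 / q.disc * (q.angle E / √(-q.disc) - 1 / q.edgeLabel E)) := by
  have hd : 0 < √(-q.disc) := Real.sqrt_pos.mpr (by linarith)
  -- In terms of u and θ the potential is (u - θ)/d³.
  have hΦ : ∀ F, q.PosAt F → 1 / q.disc * (q.angle F / √(-q.disc) - 1 / q.edgeLabel F) =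
      1 / (-q.disc * √(-q.disc)) *
        (√(-q.disc) / q.edgeLabel F - Real.arctan (√(-q.disc) / q.edgeLabel F)) := by
    intro F hF
    have he := hF.edge
    have hne := hD.ne
    rw [angle]
    field_simp
    ring
  refine h.hasSum hD (f := fun V => 1 / |q.efg V|) (C := 1 / (-q.disc * √(-q.disc)))
    (Φ := fun F => 1 / q.disc * (q.angle F / √(-q.disc) - 1 / q.edgeLabel F))
    ?_ (fun V => by positivity) ?_ ?_ ?_
  · have : 0 < -q.disc := by linarith
    positivity
  -- The angles cancel, and 1/(e + 2r) + 1/(e + 2t) - 1/e has numerator e² - 4rt = D over the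
  -- product of the three labels.
  · intro F hF
    have he := hF.edge
    have hv := hF.v
    have hw := hF.w
    have hang := hF.angle_child hD
    rw [efg_target, abs_neg, abs_of_pos (by positivity), ← hang, edgeLabel_child_true,
      edgeLabel_child_false]
    have hdisc := q.disc_eq_edge F
    have hne := hD.ne
    generalize q.angle _ = θ₁
    generalize q.angle _ = θ₂
    generalize √(-q.disc) = d at *
    generalize q.disc = D at *
    field_simp
    rw [hdisc]
    ring
  · intro F hF
    rw [hΦ F hF]
    have := arctan_le_self (div_pos hd hF.edge).le
    have : 0 < -q.disc := by linarith
    refine mul_nonneg (by positivity) (by linarith)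
  · intro F hF
    rw [hΦ F hF]
    have : 0 < -q.disc := by linarith
    exact mul_le_mul_of_nonneg_left (sub_arctan_le (div_pos hd hF.edge).le) (by positivity)

end Form

end Topograph

/-! ### The theorem, with angles rewritten through the arcsine. -/

theorem theorem1p5 (q : Topograph.Form) (E : Topograph.OrientedEdge) (D e₀ r₀ t₀ : ℝ)
    (hD : D = q.disc) (hneg : D < 0)
    (he : e₀ = q.edgeLabel E) (hr : r₀ = q.regionLabel E.v) (ht : t₀ = q.regionLabel E.w)
    (hadm : q.Admissible E) :
    |e₀ / (r₀ * t₀) * (√(-D) / 2)| ≤ 1 ∧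
    HasSum (fun V : Topograph.upperHalf E => 1 / |q.rst (V : Topograph.Vertex)|)
      (1 / D * (e₀ / (r₀ * t₀) -
        2 * Topograph.arcsinBranch (if √(-D) ≤ e₀ then 0 else 1)
          (e₀ / (r₀ * t₀) * (√(-D) / 2)) / √(-D))) ∧
    HasSum (fun V : Topograph.upperHalf E => 1 / |q.efg (V : Topograph.Vertex)|)
      (1 / D * (Real.arctan (√(-D) / e₀) / √(-D) - 1 / e₀)) := by
  subst hD he hr ht
  have h := hadm.posAt hneg
  have he := h.edge
  have hd : 0 < √(-q.disc) := Real.sqrt_pos.mpr (by linarith)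
  -- By 4rt = e² + d², x = 2u/(1 + u²) = sin 2θ, which yields both |x| ≤ 1 and the branch of the
  -- arcsine.
  have hx : q.edgeLabel E / (q.regionLabel E.v * q.regionLabel E.w) * (√(-q.disc) / 2) =
      2 * (√(-q.disc) / q.edgeLabel E) / (1 + (√(-q.disc) / q.edgeLabel E) ^ 2) := by
    have h1 : q.regionLabel E.v * q.regionLabel E.w =
        (q.edgeLabel E ^ 2 + √(-q.disc) ^ 2) / 4 := by
      rw [Real.sq_sqrt (by linarith), q.disc_eq_edge E]; ring
    rw [h1]
    generalize √(-q.disc) = d at *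
    field_simp
    ring
  rw [hx, Topograph.arcsinBranch_eq hd he]
  refine ⟨?_, ?_, h.hasSum_efg hneg⟩
  · rw [← Topograph.sin_two_mul_arctan]
    exact Real.abs_sin_le_one _
  · have hsum := h.hasSum_rst hneg
    rwa [Topograph.Form.angle, show (4 : ℝ) = 2 * 2 by norm_num, mul_assoc] at hsum
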